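/- Let $k$ be a field of characteristic zero. For a scheme $X$, let $X_{\mathrm{sm}}$ be the smooth site of $X$: the category of smooth $X$-schemes, with coverings the jointly surjective families of smooth morphisms; write $k_{\mathrm{sm}}$ for $(\operatorname{Spec} k)_{\mathrm{sm}}$, and let $D(k_{\mathrm{sm}})$ be the derived category of abelian sheaves on it. Let $\mathbb{G}_{m,X}$ be the sheaf $U\mapsto\Gamma(U,\mathcal{O}_U)^\times$ on $X_{\mathrm{sm}}$. For a proper $k$-scheme $\phi:X\to\operatorname{Spec}k$, put $$H_0(X,\mathbb{Z})_\tau:=\operatorname{Hom}_{D(k_{\mathrm{sm}})}(\tau_{\le 1}R\phi_*\mathbb{G}_{m,X},\mathbb{G}_{m,k}).$$ The degree map $\deg_\phi:H_0(X,\mathbb{Z})_\tau\to\operatorname{Hom}_{D(k_{\mathrm{sm}})}(\mathbb{G}_{m,k},\mathbb{G}_{m,k})=\mathbb{Z}$ is composition with the natural morphism $\mathbb{G}_{m,k}\to\tau_{\le 1}R\phi_*\mathbb{G}_{m,X}$ (where $n\in\mathbb{Z}$ corresponds to $n\cdot\mathrm{id}$). The truncated pseudo-index $\delta(X)$ is the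 order of $\operatorname{coker}(\deg_\phi)$, with the convention that $\delta(X)=0$ if this cokernel is infinite; thus $\delta(X)\mathbb{Z}$ is the image of $\deg_\phi$. Proposition. Let $X$ and $Y$ be proper $k$-varieties, i.e. proper geometrically integral $k$-schemes, and let $f:X\to Y$ be a morphism of $k$-schemes. Then $\delta(Y)$ divides $\delta(X)$. -/

import Mathlib

universe u

open CategoryTheory Limits AlgebraicGeometry Opposite

namespace TruncatedHomology

/-- The class of smooth morphisms of schemes. -/
abbrev smoothProp : MorphismProperty Scheme.{u} := @Smooth

/-- The category underlying the smooth site `X_sm`: smooth `X`-schemes and all `X`-morphisms. -/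
abbrev SmoothSite (X : Scheme.{u}) : Type (u + 1) := MorphismProperty.Over smoothProp ⊤ X

/-- The functor sending a smooth `X`-scheme to its underlying scheme. -/
abbrev SmoothSite.toScheme (X : Scheme.{u}) : SmoothSite X ⥤ Scheme.{u} :=
  MorphismProperty.Over.forget smoothProp ⊤ X ⋙ Over.forget X

/-- The coverings of `X_sm`: jointly surjective families of smooth morphisms. -/
def smoothPrecoverage (X : Scheme.{u}) : Precoverage (SmoothSite X) :=
  (Scheme.precoverage smoothProp).comap (SmoothSite.toScheme X)

/-- The smooth topology: the Grothendieck topology generated by the jointly surjective families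
of smooth morphisms. -/
def smoothTopology (X : Scheme.{u}) : GrothendieckTopology (SmoothSite X) :=
  (smoothPrecoverage X).toGrothendieck

instance : smoothProp.{u}.IsMultiplicative where
  id_mem _ := inferInstance

instance (X : Scheme.{u}) : EssentiallySmall.{u + 1} (SmoothSite X) := inferInstance

/-- Abelian sheaves on `X_sm`. As `X_sm` is a category with objects in `Type (u + 1)`, values are
taken in abelian groups of that universe. -/
abbrev SmSheaf (X : Scheme.{u}) := Sheaf (smoothTopology X) AddCommGrpCat.{u + 1}

instance (X : Scheme.{u}) : HasSheafify (smoothTopology X) AddCommGrpCat.{u + 1} := inferInstance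
noncomputable instance (X : Scheme.{u}) : Abelian (SmSheaf X) := inferInstance
instance (X : Scheme.{u}) : IsGrothendieckAbelian.{u + 1} (SmSheaf X) :=
  Sheaf.isGrothendieckAbelian_of_essentiallySmall (smoothTopology X) AddCommGrpCat.{u + 1}
instance (X : Scheme.{u}) : EnoughInjectives (SmSheaf X) := inferInstance

/-! Fibre products along smooth morphisms in `X_sm` exist and are those of schemes. -/

lemma pullback_prop {X : Scheme.{u}} {U V W : SmoothSite X} (f : U ⟶ W) (g : V ⟶ W)
    (hg : Smooth g.left) :
    Smooth (pullback ((MorphismProperty.Over.forget smoothProp ⊤ X).map f)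
      ((MorphismProperty.Over.forget smoothProp ⊤ X).map g)).hom := by
  have h := (IsPullback.of_hasPullback ((MorphismProperty.Over.forget smoothProp ⊤ X).map f)
      ((MorphismProperty.Over.forget smoothProp ⊤ X).map g)).map (Over.forget X)
  rw [← Over.w (pullback.fst _ _)]
  have h1 : Smooth (pullback.fst ((MorphismProperty.Over.forget smoothProp ⊤ X).map f)
      ((MorphismProperty.Over.forget smoothProp ⊤ X).map g)).left :=
    MorphismProperty.of_isPullback (P := smoothProp) h.flip hg
  have h2 : Smooth ((MorphismProperty.Over.forget smoothProp ⊤ X).obj U).hom := U.prop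
  exact MorphismProperty.comp_mem smoothProp _ _ h1 h2

noncomputable abbrev createsPullback {X : Scheme.{u}} {U V W : SmoothSite X} (f : U ⟶ W) (g : V ⟶ W)
    (hg : Smooth g.left) :
    CreatesLimit (cospan f g) (MorphismProperty.Over.forget smoothProp ⊤ X) :=
  createsLimitOfFullyFaithfulOfIso
    (MorphismProperty.Over.mk ⊤ _ (pullback_prop f g hg))
    ((Over.isoMk (Iso.refl _)) ≪≫ HasLimit.isoOfNatIso (cospanCompIso _ f g).symm)

lemma exists_smooth_of_mem {X : Scheme.{u}} {W : SmoothSite X} {R : Presieve W}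
    (hR : R ∈ smoothPrecoverage X W) {V : SmoothSite X} {g : V ⟶ W} (hg : R g) :
    Smooth g.left :=
  hR.2 (Presieve.map_map hg)

instance (X : Scheme.{u}) : (smoothPrecoverage X).HasPullbacks where
  hasPullbacks_of_mem {U W} R f hR := by
    refine ⟨fun {V g} hg ↦ ?_⟩
    let := createsPullback f g (exists_smooth_of_mem hR hg)
    have : HasPullback f g := hasLimit_of_created _ (MorphismProperty.Over.forget smoothProp ⊤ X)
    exact hasPullback_symmetry f g

instance (X : Scheme.{u}) :
    (smoothPrecoverage X).PullbacksPreservedBy (MorphismProperty.Over.forget smoothProp ⊤ X) where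
  preservesPairwisePullbacks_of_mem W R hR :=
    { preservesLimit := fun U V f g hf hg ↦ by
        let := createsPullback f g (exists_smooth_of_mem hR hg)
        infer_instance }

lemma map_isPullback {X : Scheme.{u}} {U V W T : SmoothSite X} {a : T ⟶ U} {b : T ⟶ V}
    {f : U ⟶ W} {g : V ⟶ W} (h : IsPullback a b f g) (hg : Smooth g.left) :
    IsPullback ((MorphismProperty.Over.forget smoothProp ⊤ X).map a)
      ((MorphismProperty.Over.forget smoothProp ⊤ X).map b)
      ((MorphismProperty.Over.forget smoothProp ⊤ X).map f)
      ((MorphismProperty.Over.forget smoothProp ⊤ X).map g) := by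
  let := createsPullback f g hg
  exact h.map _

instance (X : Scheme.{u}) : (smoothPrecoverage X).IsStableUnderBaseChange where
  mem_coverings_of_isPullback {ι} S Y f hf Z g P p₁ p₂ h := by
    have hs : ∀ i, Smooth (f i).left := fun i ↦ exists_smooth_of_mem hf ⟨i⟩
    simp only [smoothPrecoverage, Precoverage.mem_comap_iff, Presieve.map_ofArrows] at hf ⊢
    exact Precoverage.mem_coverings_of_isPullback _ hf _ _ _
      fun i ↦ (map_isPullback (h i) (hs i)).map (Over.forget X)

/-- The base change functor `Y_sm ⥤ X_sm`, `U ↦ U ×_Y X`. -/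
noncomputable abbrev baseChange {X Y : Scheme.{u}} (f : X ⟶ Y) : SmoothSite Y ⥤ SmoothSite X :=
  MorphismProperty.Over.pullback smoothProp ⊤ f

instance {X Y : Scheme.{u}} (f : X ⟶ Y) :
    (smoothPrecoverage Y).PullbacksPreservedBy (baseChange f) where
  preservesPairwisePullbacks_of_mem W R hR :=
    { preservesLimit := fun U V g h hg hh ↦ by
        let := createsPullback g h (exists_smooth_of_mem hR hh)
        have : PreservesLimit (cospan g h)
            (baseChange f ⋙ MorphismProperty.Over.forget smoothProp ⊤ X) :=
          inferInstanceAs <| PreservesLimit (cospan g h)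
            (MorphismProperty.Over.forget smoothProp ⊤ Y ⋙ Over.pullback f)
        exact preservesLimit_of_reflects_of_preserves _
          (MorphismProperty.Over.forget smoothProp ⊤ X) }

lemma smoothPrecoverage_le_comap_baseChange {X Y : Scheme.{u}} (f : X ⟶ Y) :
    smoothPrecoverage Y ≤ (smoothPrecoverage X).comap (baseChange f) := by
  intro W R hR
  obtain ⟨ι, Z, g, rfl⟩ := R.exists_eq_ofArrows
  simp only [smoothPrecoverage, Precoverage.mem_comap_iff, Presieve.map_ofArrows] at hR ⊢
  refine Precoverage.mem_coverings_of_isPullback _ hR (pullback.fst W.hom f) _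
    (fun i ↦ pullback.fst (Z i).hom f) fun i ↦ ?_
  have e₁ : ((baseChange f).map (g i)).left ≫ pullback.fst W.hom f =
      pullback.fst (Z i).hom f ≫ (g i).left := pullback.lift_fst _ _ _
  have e₂ : ((baseChange f).map (g i)).left ≫ pullback.snd W.hom f =
      pullback.snd (Z i).hom f := pullback.lift_snd _ _ _
  have e₃ : (g i).left ≫ W.hom = (Z i).hom := MorphismProperty.Over.w (g i)
  have t : IsPullback (pullback.snd W.hom f) (pullback.fst W.hom f) f W.hom :=
    (IsPullback.of_hasPullback W.hom f).flip
  have s : IsPullback (((baseChange f).map (g i)).left ≫ pullback.snd W.hom f)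
      (pullback.fst (Z i).hom f) f ((g i).left ≫ W.hom) := by
    rw [e₂, e₃]
    exact (IsPullback.of_hasPullback (Z i).hom f).flip
  exact IsPullback.of_right s e₁ t

instance {X Y : Scheme.{u}} (f : X ⟶ Y) :
    (baseChange f).IsContinuous (smoothTopology Y) (smoothTopology X) :=
  Functor.isContinuous_toGrothendieck_of_pullbacksPreservedBy _ _ _
    (smoothPrecoverage_le_comap_baseChange f)

instance (X : Scheme.{u}) :
    (smoothPrecoverage X).PullbacksPreservedBy (SmoothSite.toScheme X) where
  preservesPairwisePullbacks_of_mem W R hR :=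
    { preservesLimit := fun U V f g hf hg ↦ by
        let := createsPullback f g (exists_smooth_of_mem hR hg)
        infer_instance }

instance (X : Scheme.{u}) :
    (SmoothSite.toScheme X).IsContinuous (smoothTopology X) Scheme.fpqcTopology := by
  have : (SmoothSite.toScheme X).IsContinuous (smoothTopology X)
      (Scheme.precoverage smoothProp).toGrothendieck :=
    Functor.isContinuous_toGrothendieck_of_pullbacksPreservedBy _ _ _ le_rfl
  have hle : (Scheme.precoverage smoothProp).toGrothendieck ≤ Scheme.fpqcTopology.{u} :=
    (Precoverage.toGrothendieck_mono (Scheme.precoverage_mono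
      (fun _ _ g (hg : Smooth g) ↦ ⟨inferInstance, inferInstance⟩))).trans
        Scheme.fppfTopology_le_fpqcTopology
  constructor
  intro G
  exact (SmoothSite.toScheme X).op_comp_isSheaf_of_types (smoothTopology X)
    (Scheme.precoverage smoothProp).toGrothendieck ⟨G.obj, Presheaf.IsSheaf.of_le hle G.property⟩

open LaurentPolynomial

/-- The presheaf `U ↦ Γ(U, 𝒪_U)ˣ`, written additively (and lifted in universe). -/
def unitsPresheaf : Scheme.{u}ᵒᵖ ⥤ AddCommGrpCat.{u + 1} where
  obj U := AddCommGrpCat.of (ULift.{u + 1} (Additive Γ(U.unop, ⊤)ˣ))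
  map f := AddCommGrpCat.ofHom
    (AddEquiv.ulift.symm.toAddMonoidHom.comp
      ((Units.map f.unop.appTop.hom.toMonoidHom).toAdditive.comp AddEquiv.ulift.toAddMonoidHom))
  map_id U := by ext; simp
  map_comp f g := by ext; simp; rfl

/-- The morphism to `Spec A[T;T⁻¹]` given by a ring morphism `s` and a unit `a`. -/
noncomputable def toTorus {A : CommRingCat.{u}} {U : Scheme.{u}} (s : A ⟶ Γ(U, ⊤)) (a : Γ(U, ⊤)ˣ) :
    U ⟶ Spec (.of (LaurentPolynomial A)) :=
  U.toSpecΓ ≫ Spec.map (CommRingCat.ofHom (LaurentPolynomial.eval₂ s.hom a))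

/-- The unit `T` on `Spec A[T;T⁻¹]`. -/
noncomputable def coord (A : CommRingCat.{u}) : Γ(Spec (.of (LaurentPolynomial A)), ⊤)ˣ :=
  Units.map (Scheme.ΓSpecIso _).inv.hom.toMonoidHom (LaurentPolynomial.isUnit_T (R := A) 1).unit

lemma toTorus_coord {A : CommRingCat.{u}} {U : Scheme.{u}} (s : A ⟶ Γ(U, ⊤)) (a : Γ(U, ⊤)ˣ) :
    Units.map (toTorus s a).appTop.hom.toMonoidHom (coord A) = a := by
  ext
  simp [toTorus, coord]

lemma toTorus_unique {A : CommRingCat.{u}} {U : Scheme.{u}} (f g : U ⟶ Spec (.of (LaurentPolynomial A)))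
   (h₁ : f ≫ Spec.map (CommRingCat.ofHom (LaurentPolynomial.C (R := A))) =
      g ≫ Spec.map (CommRingCat.ofHom (LaurentPolynomial.C (R := A))))
   (h₂ : Units.map f.appTop.hom.toMonoidHom (coord A) = Units.map g.appTop.hom.toMonoidHom (coord A)) :
   f = g := by
  apply ext_of_isAffine
  rw [← cancel_epi (Scheme.ΓSpecIso _).inv]
  ext x
  · have := congr((Scheme.ΓSpecIso A).inv ≫ Scheme.Hom.appTop $h₁)
    rw [Scheme.Hom.comp_appTop, Scheme.Hom.comp_appTop,
      ← Scheme.ΓSpecIso_inv_naturality_assoc, ← Scheme.ΓSpecIso_inv_naturality_assoc] at this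
    exact congr($(this).hom x)
  · exact congr(Units.val $h₂)

lemma isSheaf_unitsPresheaf : Presheaf.IsSheaf Scheme.fpqcTopology.{u} unitsPresheaf.{u} := by
  apply Presheaf.isSheaf_of_isSheaf_comp _ _ (forget _)
  let A : CommRingCat.{u} := .of (ULift.{u} ℤ)
  let α : yoneda.obj (Spec (.of (LaurentPolynomial A))) ⋙ uliftFunctor.{u + 1} ⟶
      unitsPresheaf ⋙ forget AddCommGrpCat.{u + 1} :=
    { app := fun U ↦ ↾fun (f : ULift (U.unop ⟶ Spec (.of (LaurentPolynomial A)))) ↦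
        (⟨.ofMul (Units.map f.down.appTop.hom.toMonoidHom (coord A))⟩ :
          ULift.{u + 1} (Additive Γ(U.unop, ⊤)ˣ))
      naturality := fun U V g ↦ by
        ext f
        rfl }
  have : ∀ U, IsIso (α.app U) := fun U ↦ by
    rw [isIso_iff_bijective]
    refine ⟨fun f g h ↦ ?_, fun a ↦ ?_⟩
    · obtain ⟨f⟩ := f
      obtain ⟨g⟩ := g
      congr 1
      refine toTorus_unique f g ?_ ?_
      · exact specULiftZIsTerminal.hom_ext _ _
      · exact Additive.ofMul.injective (congrArg ULift.down h)
    · obtain ⟨a⟩ := a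
      refine ⟨⟨toTorus (CommRingCat.ofHom ((Int.castRingHom _).comp ULift.ringEquiv.toRingHom)) a.toMul⟩, ?_⟩
      exact congrArg (fun b ↦ ULift.up (Additive.ofMul b)) (toTorus_coord _ a.toMul)
  have : IsIso α := NatIso.isIso_of_isIso_app α
  rw [← Presheaf.isSheaf_of_iso_iff (asIso α), isSheaf_iff_isSheaf_of_type,
    Presieve.isSheaf_comp_uliftFunctor_iff]
  exact GrothendieckTopology.Subcanonical.isSheaf_of_isRepresentable _

/-- The multiplicative group `𝔾_{m,X}` as a sheaf on `X_sm`: `U ↦ Γ(U, 𝒪_U)ˣ`. -/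
noncomputable def Gm (X : Scheme.{u}) : SmSheaf X :=
  ⟨(SmoothSite.toScheme X).op ⋙ unitsPresheaf,
    (SmoothSite.toScheme X).op_comp_isSheaf_of_isSheaf (smoothTopology X) Scheme.fpqcTopology _
      isSheaf_unitsPresheaf⟩

/-- The direct image `f_*` of abelian sheaves: `(f_* F)(U) = F(U ×_Y X)`. -/
noncomputable abbrev pushforward {X Y : Scheme.{u}} (f : X ⟶ Y) : SmSheaf X ⥤ SmSheaf Y :=
  (baseChange f).sheafPushforwardContinuous AddCommGrpCat.{u + 1}
    (smoothTopology Y) (smoothTopology X)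

/-- The morphism of sheaves `𝔾_{m,Y} ⟶ f_* 𝔾_{m,X}`, given on `U` by the pullback of units along the
projection `U ×_Y X ⟶ U`. -/
noncomputable def unitsPullback {X Y : Scheme.{u}} (f : X ⟶ Y) :
    Gm Y ⟶ (pushforward f).obj (Gm X) :=
  ⟨{ app := fun V ↦ unitsPresheaf.map (pullback.fst V.unop.hom f).op
     naturality := fun V W g ↦ by
       have h : ((baseChange f).map g.unop).left ≫ pullback.fst V.unop.hom f =
         pullback.fst W.unop.hom f ≫ g.unop.left := pullback.lift_fst _ _ _
       exact (unitsPresheaf.map_comp _ _).symm.trans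
         (congr(unitsPresheaf.map (Quiver.Hom.op $h)).symm.trans (unitsPresheaf.map_comp _ _)) }⟩

instance {X Y : Scheme.{u}} (f : X ⟶ Y) : (pushforward f).Additive where
  map_add := rfl

noncomputable instance (X : Scheme.{u}) : HasDerivedCategory (SmSheaf X) :=
  HasDerivedCategory.standard _

/-- The total right derived functor `Rf_*` on bounded below derived categories. -/
noncomputable abbrev Rpush {X Y : Scheme.{u}} (f : X ⟶ Y) :
    DerivedCategory.Plus (SmSheaf X) ⥤ DerivedCategory.Plus (SmSheaf Y) :=
  (pushforward f).rightDerivedFunctorPlus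

open DerivedCategory

/-- The canonical morphism `(f_* F)[0] ⟶ Rf_* (F[0])`, where `F[0]` is the complex concentrated in
degree zero: the identification of `(f_* F)[0]` with `f_* (F[0])` followed by the unit of the
derived functor. -/
noncomputable def singleComparison {X Y : Scheme.{u}} (f : X ⟶ Y) (F : SmSheaf X) :
    (DerivedCategory.Plus.singleFunctor _ 0).obj ((pushforward f).obj F) ⟶
    (Rpush f).obj ((DerivedCategory.Plus.singleFunctor _ 0).obj F) :=
  (Plus.Qh.map (ObjectProperty.homMk ((HomotopyCategory.quotient _ _).map
      ((HomologicalComplex.singleMapHomologicalComplex (pushforward f) (ComplexShape.up ℤ) 0).inv.app F))) :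
      Plus.Qh.obj ((HomotopyCategory.Plus.singleFunctor _ 0).obj ((pushforward f).obj F)) ⟶
      Plus.Qh.obj ((pushforward f).mapHomotopyCategoryPlus.obj
        ((HomotopyCategory.Plus.singleFunctor _ 0).obj F)))
    ≫ (pushforward f).rightDerivedFunctorPlusUnit.app
      ((HomotopyCategory.Plus.singleFunctor _ 0).obj F)

/-- The complex `τ_{≤ 1} Rf_* 𝔾_{m,X}` in `D(Y_sm)`. -/
noncomputable def truncRpushGm {X Y : Scheme.{u}} (f : X ⟶ Y) : DerivedCategory (SmSheaf Y) :=
  (TStructure.t.truncLE 1).obj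
    (Plus.ι.obj ((Rpush f).obj ((Plus.singleFunctor _ 0).obj (Gm X))))

/-- The sheaf `𝔾_{m,X}` as an object of `D(X_sm)` concentrated in degree zero. -/
noncomputable abbrev GmD (X : Scheme.{u}) : DerivedCategory (SmSheaf X) :=
  (singleFunctor _ 0).obj (Gm X)

instance (X : Scheme.{u}) : TStructure.t.IsLE (GmD X) 1 :=
  TStructure.t.isLE_of_le (GmD X) 0 1 (by lia)

/-- The natural morphism `𝔾_{m,Y} ⟶ τ_{≤ 1} Rf_* 𝔾_{m,X}`: the unique lift of the composition
`𝔾_{m,Y} ⟶ f_* 𝔾_{m,X} ⟶ Rf_* 𝔾_{m,X}` through the truncation. -/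
noncomputable def naturalMap {X Y : Scheme.{u}} (f : X ⟶ Y) : GmD Y ⟶ truncRpushGm f :=
  TStructure.t.liftTruncLE (X := GmD Y)
    (Plus.ι.map ((Plus.singleFunctor _ 0).map (unitsPullback f) ≫ singleComparison f (Gm X))) 1

lemma exists_eq_of_isUnit {k : Type u} [Field k] {a : LaurentPolynomial k} (ha : IsUnit a) :
    ∃ (c : k) (n : ℤ), a = C c * T n := by
  obtain ⟨b, hb⟩ := ha.exists_right_inv
  obtain ⟨n, p, hp⟩ := exists_T_pow a
  obtain ⟨m, q, hq⟩ := exists_T_pow b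
  have h : p * q = Polynomial.X ^ (n + m) := by
    apply Polynomial.toLaurent_injective
    rw [map_mul, hp, hq, Polynomial.toLaurent_X_pow, mul_mul_mul_comm, hb, one_mul, ← T_add]
    simp
  obtain ⟨i, -, hi⟩ := (dvd_prime_pow Polynomial.prime_X _).mp (Dvd.intro _ h)
  obtain ⟨v, hv⟩ := hi.symm
  obtain ⟨c, -, hc⟩ := Polynomial.isUnit_iff.mp v.isUnit
  refine ⟨c, i - n, ?_⟩
  have : a * T n * T (-n) = a := by rw [mul_T_assoc, add_neg_cancel, T_zero, mul_one]
  rw [← this, ← hp, ← hv, ← hc, map_mul, Polynomial.toLaurent_X_pow, Polynomial.toLaurent_C,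
    sub_eq_add_neg, T_add, mul_comm (T _) (C c), mul_assoc]

lemma smooth_C (k : Type u) [Field k] :
    Smooth (Spec.map (CommRingCat.ofHom (LaurentPolynomial.C (R := k)))) := by
  have : IsScalarTower k (Polynomial k) (LaurentPolynomial k) :=
    .of_algebraMap_eq fun x ↦ (Polynomial.toLaurent_C x).symm
  have h₁ : Algebra.Smooth k (Polynomial k) := ⟨inferInstance, inferInstance⟩
  have h₂ : Algebra.Smooth (Polynomial k) (LaurentPolynomial k) :=
    .of_isLocalization_Away (Polynomial.X)
  have h₃ : Algebra.Smooth k (LaurentPolynomial k) := .comp k (Polynomial k) _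
  rw [HasRingHomProperty.Spec_iff (P := @Smooth)]
  exact RingHom.smooth_algebraMap.mpr h₃

lemma toTorus_appTop {A : CommRingCat.{u}} {U : Scheme.{u}} (s : A ⟶ Γ(U, ⊤)) (a : Γ(U, ⊤)ˣ) :
    (Scheme.ΓSpecIso _).inv ≫ (toTorus s a).appTop =
      CommRingCat.ofHom (LaurentPolynomial.eval₂ s.hom a) := by
  simp [toTorus]

lemma toTorus_comp {A : CommRingCat.{u}} {U : Scheme.{u}} (g : U ⟶ Spec A) (a : Γ(U, ⊤)ˣ) :
    toTorus ((Scheme.ΓSpecIso A).inv ≫ g.appTop) a ≫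
      Spec.map (CommRingCat.ofHom LaurentPolynomial.C) = g := by
  have : CommRingCat.ofHom (LaurentPolynomial.C (R := A)) ≫ CommRingCat.ofHom
      (LaurentPolynomial.eval₂ ((Scheme.ΓSpecIso A).inv ≫ g.appTop).hom a) =
      (Scheme.ΓSpecIso A).inv ≫ g.appTop := by
    ext x
    simp
  rw [toTorus, Category.assoc, ← Spec.map_comp, this]
  simp [Spec.map_comp, ← Scheme.toSpecΓ_naturality_assoc]

/-- The action of an endomorphism of the sheaf of units on units. -/
noncomputable def onUnits {S : Scheme.{u}} (χ : Gm S ⟶ Gm S) (U : SmoothSite S)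
    (a : Γ(U.left, ⊤)ˣ) : Γ(U.left, ⊤)ˣ :=
  ((χ.hom.app (op U)).hom (ULift.up (Additive.ofMul a) : ULift (Additive Γ(U.left, ⊤)ˣ)) :
    ULift (Additive Γ(U.left, ⊤)ˣ)).down.toMul

lemma onUnits_naturality {S : Scheme.{u}} (χ : Gm S ⟶ Gm S) {U V : SmoothSite S} (g : U ⟶ V)
    (a : Γ(V.left, ⊤)ˣ) :
    onUnits χ U (a.map g.left.appTop.hom.toMonoidHom) =
      (onUnits χ V a).map g.left.appTop.hom.toMonoidHom :=
  congr(($(χ.hom.naturality g.op).hom (ULift.up (Additive.ofMul a) :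
    ULift (Additive Γ(V.left, ⊤)ˣ)) : ULift (Additive Γ(U.left, ⊤)ˣ)).down.toMul)

lemma onUnits_one {S : Scheme.{u}} (χ : Gm S ⟶ Gm S) (U : SmoothSite S) :
    onUnits χ U 1 = 1 :=
  congr(($(map_zero (χ.hom.app (op U)).hom) : ULift (Additive Γ(U.left, ⊤)ˣ)).down.toMul)

lemma onUnits_ext {S : Scheme.{u}} {χ₁ χ₂ : Gm S ⟶ Gm S}
    (h : ∀ U a, onUnits χ₁ U a = onUnits χ₂ U a) : χ₁ = χ₂ := by
  ext U a
  exact congr(ULift.up (Additive.ofMul $(h U.unop a.down.toMul)))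

lemma onUnits_zsmul_id {S : Scheme.{u}} (n : ℤ) (U : SmoothSite S) (a : Γ(U.left, ⊤)ˣ) :
    onUnits (n • 𝟙 (Gm S)) U a = a ^ n := by
  have h : ∀ (m : ℤ) , ((m • 𝟙 (Gm S) : Gm S ⟶ Gm S).hom.app (op U)) =
      m • 𝟙 ((Gm S).obj.obj (op U)) := by
    intro m
    rfl
  rw [onUnits, h]
  rfl

/-- The torus `Spec k[T;T⁻¹]` as a smooth `k`-scheme. -/
noncomputable abbrev torus (k : Type u) [Field k] : SmoothSite (Spec (.of k)) :=
  .mk ⊤ (Spec.map (CommRingCat.ofHom (LaurentPolynomial.C (R := k)))) (smooth_C k)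

/-- The coordinate of the torus. -/
noncomputable abbrev torusCoord (k : Type u) [Field k] : Γ((torus k).left, ⊤)ˣ :=
  coord (.of k)

lemma exists_eq_zsmul {k : Type u} [Field k]
    (χ : Gm (Spec (.of k)) ⟶ Gm (Spec (.of k))) : ∃ n : ℤ, n • 𝟙 _ = χ := by
  let w := onUnits χ (torus k) (torusCoord k)
  obtain ⟨c, n, hcn⟩ := exists_eq_of_isUnit (k := k)
    (w.map (Scheme.ΓSpecIso (.of (LaurentPolynomial k))).hom.hom.toMonoidHom).isUnit
  have hw : (w : Γ((torus k).left, ⊤)) =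
      (Scheme.ΓSpecIso (.of (LaurentPolynomial k))).inv.hom (C c * T n) := by
    rw [← hcn]
    exact congr($((Scheme.ΓSpecIso (.of (LaurentPolynomial k))).hom_inv_id.symm).hom w.val)
  let s (U : SmoothSite (Spec (.of k))) : CommRingCat.of k ⟶ Γ(U.left, ⊤) :=
    (Scheme.ΓSpecIso (.of k)).inv ≫ U.hom.appTop
  have key (U : SmoothSite (Spec (.of k))) (a : Γ(U.left, ⊤)ˣ) :
      (onUnits χ U a : Γ(U.left, ⊤)) = (s U).hom c * (a ^ n : Γ(U.left, ⊤)ˣ).val := by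
    let g : U ⟶ torus k := MorphismProperty.Over.homMk (toTorus (s U) a) (toTorus_comp U.hom a)
    have h₁ := onUnits_naturality χ g (torusCoord k)
    have h₂ : (torusCoord k).map g.left.appTop.hom.toMonoidHom = a := toTorus_coord (s U) a
    rw [h₂] at h₁
    refine (congr(Units.val $h₁)).trans ?_
    refine (congr(g.left.appTop.hom $hw)).trans ?_
    refine (congr($(toTorus_appTop (s U) a).hom (C c * T n))).trans ?_
    exact LaurentPolynomial.eval₂_C_mul_T _ _ _ _
  refine ⟨n, onUnits_ext fun U a ↦ ?_⟩
  have h₁ := key U 1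
  rw [onUnits_one, one_zpow, Units.val_one, mul_one] at h₁
  rw [onUnits_zsmul_id]
  ext
  rw [key, ← h₁, one_mul]

lemma zsmul_injective {k : Type u} [Field k] {n : ℤ}
    (h : n • 𝟙 (Gm (Spec (.of k))) = 0) : n = 0 := by
  have h₁ := onUnits_zsmul_id n (torus k) (torusCoord k)
  have h₂ := onUnits_zsmul_id 0 (torus k) (torusCoord k)
  rw [h] at h₁
  rw [zero_zsmul, h₁, zpow_zero] at h₂
  have h₄ : (LaurentPolynomial.isUnit_T (R := k) 1).unit ^ n = 1 := by
    apply Units.map_injective (f := (Scheme.ΓSpecIso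
      (.of (LaurentPolynomial k))).inv.hom.toMonoidHom)
    · exact (Scheme.ΓSpecIso (.of (LaurentPolynomial k))).commRingCatIsoToRingEquiv.symm.injective
    · rw [map_zpow, map_one]
      exact h₂
  have h₅ : (T n : LaurentPolynomial k) = 1 := by
    have h : LaurentPolynomial.eval₂ (C (R := k)) (isUnit_T (R := k) 1).unit =
        RingHom.id _ := by
      ext <;> simp
    have h' := LaurentPolynomial.eval₂_T (C (R := k)) (isUnit_T (R := k) 1).unit n
    rw [h, h₄] at h'
    exact h'
  rw [← T_zero] at h₅
  have h₆ := congr(($h₅).coeff n)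
  rw [T_apply, T_apply, if_pos rfl] at h₆
  by_contra hn
  rw [if_neg (Ne.symm hn)] at h₆
  exact one_ne_zero h₆

/-- The identification `ℤ = Hom_{D(k_sm)}(𝔾_{m,k}, 𝔾_{m,k})` sending `n` to `n • 𝟙`. -/
noncomputable def intEquivEndGm (k : Type u) [Field k] : ℤ ≃+ (GmD (Spec (.of k)) ⟶ GmD (Spec (.of k))) :=
  AddEquiv.ofBijective (zmultiplesHom _ (𝟙 (GmD (Spec (.of k))))) <| by
    refine ⟨(injective_iff_map_eq_zero _).mpr fun n hn ↦ ?_, fun χ ↦ ?_⟩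
    · apply zsmul_injective (k := k)
      apply (DerivedCategory.singleFunctor (SmSheaf (Spec (.of k))) 0).map_injective
      refine Eq.trans ?_ (hn.trans (Functor.map_zero _ _ _).symm)
      refine (Functor.map_zsmul _).trans ?_
      exact congr(n • $((DerivedCategory.singleFunctor _ 0).map_id _))
    · obtain ⟨χ, rfl⟩ := (DerivedCategory.singleFunctor _ 0).map_surjective χ
      obtain ⟨n, rfl⟩ := exists_eq_zsmul χ
      refine ⟨n, ?_⟩
      refine Eq.trans ?_ (Functor.map_zsmul _).symm
      exact congr(n • $(((DerivedCategory.singleFunctor _ 0).map_id _).symm))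

/-- The truncated homology group `H_0(X, ℤ)_τ = Hom_{D(k_sm)}(τ_{≤ 1} Rφ_* 𝔾_{m,X}, 𝔾_{m,k})`. -/
abbrev truncatedHomologyZero {k : Type u} [Field k] {X : Scheme.{u}} (φ : X ⟶ Spec (.of k)) : Type _ :=
  truncRpushGm φ ⟶ GmD (Spec (.of k))

/-- The degree map `H_0(X, ℤ)_τ ⟶ ℤ`: composition with the natural morphism
`𝔾_{m,k} ⟶ τ_{≤ 1} Rφ_* 𝔾_{m,X}`, with values in `Hom(𝔾_{m,k}, 𝔾_{m,k}) = ℤ`. -/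
noncomputable def deg {k : Type u} [Field k] {X : Scheme.{u}} (φ : X ⟶ Spec (.of k)) :
    truncatedHomologyZero φ →+ ℤ :=
  (intEquivEndGm k).symm.toAddMonoidHom.comp (Preadditive.leftComp _ (naturalMap φ))

/-- The truncated pseudo-index: the order of the cokernel of the degree map. It is the nonnegative
generator of the image of the degree map, hence `0` if the cokernel is infinite. -/
noncomputable def pseudoIndex {k : Type u} [Field k] {X : Scheme.{u}} (φ : X ⟶ Spec (.of k)) : ℕ :=
  Nat.card (ℤ ⧸ (deg φ).range)

end TruncatedHomology

/-! Everything reduces to an inclusion of subgroups of `ℤ`: the image of the degree map of `f ≫ ψ`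
lies in that of `ψ`, so its index is a multiple. For this it suffices to have a morphism `τ_{≤ 1}
Rψ_* 𝔾_{m,Y} ⟶ τ_{≤ 1} R(f ≫ ψ)_* 𝔾_{m,X}` compatible with the natural maps from `𝔾_{m,k}`, since
precomposing with it preserves degrees (`exists_truncRpushGm_map`).

The expected morphism is `Rψ_*` of `𝔾_{m,Y} ⟶ Rf_* 𝔾_{m,X}`, followed by `Rψ_* Rf_* ≅ R(f ≫ ψ)_*`.
On smooth sites the inverse image is not exact in general, so `f_*` cannot be assumed to preserve
injectives, and the last isomorphism is not formal. In degrees `≤ 1`, however, only `R¹ψ_* (f_* J) =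
0` for `J` injective is needed, and in fact only for the degree 0 term of an injective resolution
(`isIso_truncLE_one_map`).

This vanishing is a Čech argument (`surjective_app_of_injective`). Given an extension of sheaves
starting with `f_* J`, local lifts of a section differ by a Čech 1-cocycle, which extends to the
base-changed cover over `X`. There it is a coboundary, because `J` is injective as a presheaf
(`exists_coboundary`). The corrected lifts then glue. -/

namespace TruncatedHomology

/-! ### Left exact functors and derived functors in degrees `≤ 1` -/

section Homological

open DerivedCategory HomologicalComplex

variable {C D : Type*} [Category* C] [Category* D] [Abelian C] [Abelian D]

/-- The class of objects `A` such that `F` preserves the exactness of all short exact sequences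
starting with `A` (when `F` is left exact, this means that `R¹F` vanishes on `A`). -/
def IsOneAcyclic (F : C ⥤ D) (A : C) : Prop :=
  ∀ ⦃B Q : C⦄ (i : A ⟶ B) (p : B ⟶ Q) (w : i ≫ p = 0),
    (ShortComplex.mk i p w).ShortExact → Epi (F.map p)

omit [Abelian D] in
lemma IsOneAcyclic.of_iso {F : C ⥤ D} {A A' : C} (h : IsOneAcyclic F A) (e : A ≅ A') :
    IsOneAcyclic F A' := by
  intro B Q i p w hS
  refine h (e.hom ≫ i) p (by simp [w]) ?_
  let α : ShortComplex.mk i p w ≅ ShortComplex.mk (e.hom ≫ i) p (by simp [w]) :=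
    ShortComplex.isoMk e.symm (Iso.refl _) (Iso.refl _) (by simp) (by simp)
  exact ShortComplex.shortExact_of_iso α hS

variable (F : C ⥤ D) [F.Additive] [PreservesFiniteLimits F]

/-- `d₁` factors through a monomorphism out of `cokernel d₀`. Acyclicity of `A₀` makes `F(A₁)`
surject onto `F (cokernel d₀)`, so `F(d₁)` has the same image as `F` of that monomorphism, to which
left exactness applies. -/
lemma exact_map_of_isOneAcyclic {A₀ A₁ A₂ A₃ : C} (d₀ : A₀ ⟶ A₁) (d₁ : A₁ ⟶ A₂) (d₂ : A₂ ⟶ A₃)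
    (w₀ : d₀ ≫ d₁ = 0) (w₁ : d₁ ≫ d₂ = 0) [Mono d₀]
    (h₀ : (ShortComplex.mk d₀ d₁ w₀).Exact) (h₁ : (ShortComplex.mk d₁ d₂ w₁).Exact)
    (hA : IsOneAcyclic F A₀) :
    ((ShortComplex.mk d₁ d₂ w₁).map F).Exact := by
  let q : cokernel d₀ ⟶ A₂ := cokernel.desc d₀ d₁ w₀
  have : Mono q := h₀.mono_cokernelDesc
  have hq : cokernel.π d₀ ≫ q = d₁ := cokernel.π_desc _ _ _
  have w₂ : q ≫ d₂ = 0 := by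
    rw [← cancel_epi (cokernel.π d₀), reassoc_of% hq, w₁, comp_zero]
  have : Epi (F.map (cokernel.π d₀)) :=
    hA d₀ (cokernel.π d₀) (cokernel.condition d₀)
      { exact := ShortComplex.exact_cokernel d₀ }
  let S : ShortComplex C := ShortComplex.mk q d₂ w₂
  let f : ShortComplex.mk d₁ d₂ w₁ ⟶ S :=
    { τ₁ := cokernel.π d₀, τ₂ := 𝟙 _, τ₃ := 𝟙 _ }
  have hS : S.Exact := (ShortComplex.exact_iff_of_epi_of_isIso_of_mono f).1 h₁
  have hFS : (S.map F).Exact := hS.map_of_mono_of_preservesKernel F (by assumption) inferInstance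
  let Ff := F.mapShortComplex.map f
  have : Epi Ff.τ₁ := by assumption
  have : IsIso Ff.τ₂ := inferInstanceAs (IsIso (F.map (𝟙 A₂)))
  have : Mono Ff.τ₃ := inferInstanceAs (Mono (F.map (𝟙 A₃)))
  exact (ShortComplex.exact_iff_of_epi_of_isIso_of_mono Ff).2 hFS

/-- A left exact functor keeps an acyclic complex in degrees `≥ -1` exact in degrees `≤ 1` if its
first term has no first cohomology. -/
lemma isGE_map_of_acyclic (K : CochainComplex C ℤ) [K.IsStrictlyGE (-1)] (hK : K.Acyclic)
    (hA : IsOneAcyclic F (K.X (-1))) :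
    CochainComplex.IsGE ((F.mapHomologicalComplex (ComplexShape.up ℤ)).obj K) 2 := by
  have hex (i : ℤ) : (ShortComplex.mk (K.d (i - 1) i) (K.d i (i + 1)) (by simp)).Exact :=
    (K.exactAt_iff' (i - 1) i (i + 1) (by simp) (by simp)).1 (hK i)
  have hmono : Mono (K.d (-1) 0) :=
    (hex (-1)).mono_g ((K.isZero_of_isStrictlyGE (-1) (-1 - 1)).eq_of_src _ _)
  rw [CochainComplex.isGE_iff]
  intro i hi
  rw [HomologicalComplex.exactAt_iff' _ (i - 1) i (i + 1) (by simp) (by simp)]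
  change ((ShortComplex.mk (K.d (i - 1) i) (K.d i (i + 1)) (by simp)).map F).Exact
  -- Degree 1 is the only one where acyclicity enters. In degrees `≤ 0` the incoming differential is
  -- a monomorphism, from a zero object if `i < 0`, and left exactness suffices.
  by_cases h₁ : i = 1
  · subst h₁
    exact exact_map_of_isOneAcyclic F (K.d (-1) 0) _ _ (by simp) _ (hex 0) (hex 1) hA
  · have : Mono (K.d (i - 1) i) := by
      by_cases h₀ : i = 0
      · subst h₀; exact hmono
      · exact ⟨fun _ _ _ ↦ (K.isZero_of_isStrictlyGE (-1) (i - 1)).eq_of_tgt _ _⟩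
    exact (hex i).map_of_mono_of_preservesKernel F this inferInstance

variable [HasDerivedCategory C] [HasDerivedCategory D]

lemma acyclic_mappingCone {K L : CochainComplex C ℤ} (w : K ⟶ L) [QuasiIso w] :
    (CochainComplex.mappingCone w).Acyclic := by
  have : IsIso (Q.map w) := inferInstance
  have h := Pretriangulated.Triangle.isZero₃_of_isIso₁ _ (mappingCone_triangle_distinguished w) this
  intro i
  rw [exactAt_iff_isZero_homology]
  exact ((homologyFunctor C i).map_isZero h).of_iso ((homologyFunctorFactors C i).app _).symm

/-- The cone of `w` is acyclic and starts in degree `-1` with `K.X 0`. By the previous lemma its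
image under `F`, which is the cone of `F(w)`, has no cohomology in degrees `≤ 1`. -/
lemma isIso_truncLE_one_map {K L : CochainComplex C ℤ} (w : K ⟶ L) [QuasiIso w]
    [K.IsStrictlyGE 0] [L.IsStrictlyGE 0] (hA : IsOneAcyclic F (K.X 0)) :
    IsIso ((TStructure.t.truncLE 1).map
      (Q.map ((F.mapHomologicalComplex (ComplexShape.up ℤ)).map w))) := by
  have := CochainComplex.isStrictlyGE_mappingCone w 0 0 (-1)
  -- The degree `-1` term of the cone is `K.X 0 ⊞ L.X (-1)`, and the second summand vanishes.
  have e : K.X 0 ≅ (CochainComplex.mappingCone w).X (-1) :=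
    { hom := (CochainComplex.mappingCone.inl w).v 0 (-1) (by simp)
      inv := (CochainComplex.mappingCone.fst w).1.v (-1) 0 (by simp)
      hom_inv_id := by simp
      inv_hom_id := by
        rw [← CochainComplex.mappingCone.id_X w (-1) 0 (by simp)]
        have : (CochainComplex.mappingCone.snd w).v (-1) (-1) (by simp) = 0 :=
          (L.isZero_of_isStrictlyGE 0 (-1)).eq_of_tgt _ _
        simp [this] }
  have h := isGE_map_of_acyclic F (CochainComplex.mappingCone w) (acyclic_mappingCone w)
    (hA.of_iso e)
  refine TStructure.t.isIso₁_truncLE_map_of_isGE _ (mappingCone_triangle_distinguished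
    ((F.mapHomologicalComplex (ComplexShape.up ℤ)).map w)) 1 2 (by simp) ?_
  rw [← isGE_Q_obj_iff] at h
  exact TStructure.t.isGE_of_iso
    (Q.mapIso (CochainComplex.mappingCone.mapHomologicalComplexIso w F)) 2

/-- The canonical morphism `F(K) ⟶ RF(K)` is an isomorphism in degrees `≤ 1` if the first term
of the complex `K` has no first cohomology. -/
lemma isIso_truncLE_one_map_rightDerivedFunctorPlusUnit [EnoughInjectives C]
    (K : CochainComplex.Plus C) [K.obj.IsStrictlyGE 0] (hA : IsOneAcyclic F (K.obj.X 0)) :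
    IsIso ((TStructure.t.truncLE 1).map (Plus.ι.map
      (F.rightDerivedFunctorPlusUnit.app ((HomotopyCategory.Plus.quotient C).obj K)))) := by
  -- The unit is an isomorphism on a bounded below complex of injectives `L`. Its naturality along
  -- `w : K ⟶ L` carries this back to `K` after truncation.
  obtain ⟨L, w, _, _, _⟩ :=
    CochainComplex.Plus.modelCategoryQuillen.exists_quasiIso_injective K.obj 0
  let L' : CochainComplex.Plus C := ⟨L, 0, inferInstance⟩
  let w' : K ⟶ L' := ObjectProperty.homMk w
  let w'' := (HomotopyCategory.Plus.quotient C).map w'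
  have hw : IsIso (Plus.Qh.map w'') := by
    have : IsIso (Plus.ι.map (Plus.Qh.map w'')) := inferInstanceAs (IsIso (Q.map w))
    exact isIso_of_fully_faithful Plus.ι _
  have : ∀ n, Injective (L'.obj.X n) := by assumption
  have : IsIso (F.rightDerivedFunctorPlusUnit.app ((HomotopyCategory.Plus.quotient C).obj L')) :=
    inferInstance
  have nat := F.rightDerivedFunctorPlusUnit.naturality w''
  have h := congr((TStructure.t.truncLE 1).map (Plus.ι.map $nat))
  simp only [Functor.comp_map, Functor.map_comp] at h
  have h₁ : IsIso ((TStructure.t.truncLE 1).map (Plus.ι.map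
      (Plus.Qh.map (F.mapHomotopyCategoryPlus.map w'')))) :=
    isIso_truncLE_one_map F w hA
  have h₂ : IsIso ((TStructure.t.truncLE 1).map (Plus.ι.map
      (F.rightDerivedFunctorPlusUnit.app ((HomotopyCategory.Plus.quotient C).obj L')))) :=
    inferInstance
  have h₃ := IsIso.comp_isIso' h₁ h₂
  rw [h] at h₃
  exact IsIso.of_isIso_comp_right _ ((TStructure.t.truncLE 1).map (Plus.ι.map
    (F.rightDerivedFunctorPlus.map (Plus.Qh.map w''))))

end Homological

/-! ### Comparison of derived functors of a composition -/

section Comparison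

open DerivedCategory HomologicalComplex

/-- Formal part of the comparison: a zigzag `M ⟶ M₁ ⟵ N ⟶ M'` whose backward arrow is invertible
only after truncation still transports lifts to the truncation. -/
lemma liftTruncLE_comp_eq {T : Type*} [Category* T] [Preadditive T] [HasZeroObject T]
    [HasShift T ℤ] [∀ n : ℤ, (shiftFunctor T n).Additive] [Pretriangulated T] [IsTriangulated T]
    (t : Triangulated.TStructure T) {X M M₁ N M' : T} (r : ℤ) [t.IsLE X r]
    (n : X ⟶ M) (n' : X ⟶ M') (m : X ⟶ N)
    (a : M ⟶ M₁) (b : N ⟶ M₁) (c : N ⟶ M') [IsIso ((t.truncLE r).map b)]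
    (h : n ≫ a = m ≫ b) (h' : m ≫ c = n') :
    t.liftTruncLE n r ≫ (t.truncLE r).map a ≫ inv ((t.truncLE r).map b) ≫ (t.truncLE r).map c =
      t.liftTruncLE n' r := by
  have key : t.liftTruncLE n r ≫ (t.truncLE r).map a =
      t.liftTruncLE m r ≫ (t.truncLE r).map b := by
    apply t.to_truncLE_obj_ext
    simp [h]
  rw [reassoc_of% key, IsIso.hom_inv_id_assoc]
  apply t.to_truncLE_obj_ext
  simp [h']

variable {C D E : Type*} [Category* C] [Category* D] [Category* E]
  [Abelian C] [Abelian D] [Abelian E]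

/-- The identification of `(F A)[0]` with `F (A[0])` in the bounded below homotopy category. -/
noncomputable def singleMap (F : C ⥤ D) [F.Additive] (A : C) :
    (HomotopyCategory.Plus.singleFunctor D 0).obj (F.obj A) ⟶
      F.mapHomotopyCategoryPlus.obj ((HomotopyCategory.Plus.singleFunctor C 0).obj A) :=
  ObjectProperty.homMk ((HomotopyCategory.quotient _ _).map
    ((singleMapHomologicalComplex F (ComplexShape.up ℤ) 0).inv.app A))

/-- The isomorphism of complexes `G (F K) ≅ H K` induced by `F ⋙ G ≅ H`. -/
noncomputable def mapCompIso {F : C ⥤ D} {G : D ⥤ E} {H : C ⥤ E} [F.Additive] [G.Additive]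
    [H.Additive] (e : F ⋙ G ≅ H) (K : CochainComplex C ℤ) :
    (G.mapHomologicalComplex (ComplexShape.up ℤ)).obj
        ((F.mapHomologicalComplex (ComplexShape.up ℤ)).obj K) ≅
      (H.mapHomologicalComplex (ComplexShape.up ℤ)).obj K :=
  Hom.isoOfComponents (fun i ↦ e.app (K.X i)) (fun i j _ ↦ (e.hom.naturality (K.d i j)).symm)

-- The degree 0 content of `single_comp_eq`, with arbitrary isomorphisms in place of the
-- identifications of the degree 0 terms of single complexes.
omit [Abelian C] [Abelian D] [Abelian E] in
lemma conj_comp_eq {F : C ⥤ D} {G : D ⥤ E} {H : C ⥤ E} (e : F ⋙ G ≅ H) {A A₁ K : C} {A' A₁' X : D}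
    {B B₁ Y Z : E} (g : A' ⟶ F.obj A) (v : B ⟶ G.obj A') (j : A₁ ⟶ K) (sA : A₁ ≅ A)
    (sA' : A₁' ≅ A') (sB : B₁ ≅ B) (sF : X ≅ F.obj A) (sG : Y ≅ G.obj A') (sH : Z ≅ H.obj A) :
    (sB.hom ≫ (v ≫ G.map g ≫ e.hom.app A) ≫ sH.inv) ≫ (sH.hom ≫ H.map sA.inv) ≫ H.map j =
      ((sB.hom ≫ v ≫ sG.inv) ≫ (sG.hom ≫ G.map sA'.inv) ≫
        G.map ((sA'.hom ≫ g ≫ sF.inv) ≫ (sF.hom ≫ F.map sA.inv) ≫ F.map j)) ≫ e.hom.app K := by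
  have h₁ := e.hom.naturality j
  have h₂ := e.hom.naturality sA.inv
  rw [Functor.comp_map] at h₁ h₂
  simp only [Functor.map_comp, Category.assoc, Iso.inv_hom_id_assoc, h₁, reassoc_of% h₂,
    Iso.map_inv_hom_id_assoc]

/-- Both sides start from a complex concentrated in degree 0, so they need only be compared there,
where the naturality of `e` gives the equality. -/
lemma single_comp_eq {F : C ⥤ D} {G : D ⥤ E} {H : C ⥤ E} [F.Additive] [G.Additive]
    [H.Additive] (e : F ⋙ G ≅ H) {A : C} {A' : D} {B : E} (g : A' ⟶ F.obj A) (v : B ⟶ G.obj A')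
    {K : CochainComplex C ℤ} (j : (HomologicalComplex.single C (ComplexShape.up ℤ) 0).obj A ⟶ K) :
    (HomologicalComplex.single E (ComplexShape.up ℤ) 0).map (v ≫ G.map g ≫ e.hom.app A) ≫
        (singleMapHomologicalComplex H (ComplexShape.up ℤ) 0).inv.app A ≫
        (H.mapHomologicalComplex (ComplexShape.up ℤ)).map j =
      ((HomologicalComplex.single E (ComplexShape.up ℤ) 0).map v ≫
        (singleMapHomologicalComplex G (ComplexShape.up ℤ) 0).inv.app A' ≫
        (G.mapHomologicalComplex (ComplexShape.up ℤ)).map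
          ((HomologicalComplex.single D (ComplexShape.up ℤ) 0).map g ≫
          (singleMapHomologicalComplex F (ComplexShape.up ℤ) 0).inv.app A ≫
          (F.mapHomologicalComplex (ComplexShape.up ℤ)).map j)) ≫ (mapCompIso e K).hom := by
  apply from_single_hom_ext
  have h : (mapCompIso e K).hom.f 0 = e.hom.app (K.X 0) := rfl
  simp only [comp_f, Functor.mapHomologicalComplex_map_f, h, single_map_f_self,
    singleMapHomologicalComplex_inv_app_self]
  exact conj_comp_eq e g v (j.f 0) _ _ _ _ _ _

variable [HasDerivedCategory C] [HasDerivedCategory D] [HasDerivedCategory E]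
  [EnoughInjectives C] [EnoughInjectives D]

/-- The canonical morphism `(F A)[0] ⟶ RF (A[0])`. -/
noncomputable def singleUnit (F : C ⥤ D) [F.Additive] (A : C) :
    Plus.Qh.obj ((HomotopyCategory.Plus.singleFunctor D 0).obj (F.obj A)) ⟶
      F.rightDerivedFunctorPlus.obj
        (Plus.Qh.obj ((HomotopyCategory.Plus.singleFunctor C 0).obj A)) :=
  Plus.Qh.map (singleMap F A) ≫
    F.rightDerivedFunctorPlusUnit.app ((HomotopyCategory.Plus.singleFunctor C 0).obj A)

omit [HasDerivedCategory E] [EnoughInjectives D] [Abelian E] in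
lemma singleUnit_comp (F : C ⥤ D) [F.Additive] {A : C} {B : D} (v : B ⟶ F.obj A)
    {K : HomotopyCategory.Plus C} (j : (HomotopyCategory.Plus.singleFunctor C 0).obj A ⟶ K) :
    (Plus.Qh.map ((HomotopyCategory.Plus.singleFunctor D 0).map v) ≫ singleUnit F A) ≫
        F.rightDerivedFunctorPlus.map (Plus.Qh.map j) =
      Plus.Qh.map ((HomotopyCategory.Plus.singleFunctor D 0).map v ≫ singleMap F A ≫
        F.mapHomotopyCategoryPlus.map j) ≫
        F.rightDerivedFunctorPlusUnit.app K := by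
  have := F.rightDerivedFunctorPlusUnit.naturality j
  rw [Functor.comp_map, Functor.comp_map] at this
  rw [Functor.map_comp, Functor.map_comp, Category.assoc, Category.assoc, Category.assoc, this,
    singleUnit, Category.assoc]

/-- A morphism `A' ⟶ F A` induces a morphism `τ_{≤ 1} RG (A'[0]) ⟶ τ_{≤ 1} RH (A[0])` if `H` is the
composition of `F` and `G`, and `F` sends injective objects to objects without first cohomology. -/
lemma exists_truncLE_map {F : C ⥤ D} {G : D ⥤ E} {H : C ⥤ E} [F.Additive] [G.Additive]
    [PreservesFiniteLimits G] [H.Additive] (e : F ⋙ G ≅ H)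
    (hF : ∀ (J : C) [Injective J], IsOneAcyclic G (F.obj J))
    {A : C} {A' : D} {B : E} (g : A' ⟶ F.obj A) (v : B ⟶ G.obj A') (w : B ⟶ H.obj A)
    (hw : w = v ≫ G.map g ≫ e.hom.app A)
    [TStructure.t.IsLE
      (Plus.ι.obj (Plus.Qh.obj ((HomotopyCategory.Plus.singleFunctor E 0).obj B))) 1] :
    ∃ t : (TStructure.t.truncLE 1).obj (Plus.ι.obj (G.rightDerivedFunctorPlus.obj
          (Plus.Qh.obj ((HomotopyCategory.Plus.singleFunctor D 0).obj A')))) ⟶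
        (TStructure.t.truncLE 1).obj (Plus.ι.obj (H.rightDerivedFunctorPlus.obj
          (Plus.Qh.obj ((HomotopyCategory.Plus.singleFunctor C 0).obj A)))),
      TStructure.t.liftTruncLE (Plus.ι.map
        (Plus.Qh.map ((HomotopyCategory.Plus.singleFunctor E 0).map v) ≫ singleUnit G A')) 1 ≫ t =
      TStructure.t.liftTruncLE (Plus.ι.map
        (Plus.Qh.map ((HomotopyCategory.Plus.singleFunctor E 0).map w) ≫ singleUnit H A)) 1 := by
  let R : InjectiveResolution A := InjectiveResolution.of A
  let J : CochainComplex.Plus C := ⟨R.cochainComplex, 0, inferInstance⟩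
  have : ∀ n, Injective (J.obj.X n) := fun n ↦ inferInstanceAs (Injective (R.cochainComplex.X n))
  let K : CochainComplex.Plus D := F.mapCochainComplexPlus.obj J
  have : K.obj.IsStrictlyGE 0 := inferInstanceAs (CochainComplex.IsStrictlyGE
    ((F.mapHomologicalComplex (ComplexShape.up ℤ)).obj R.cochainComplex) 0)
  -- Here `K` is `F` of an injective resolution `J` of `A`. `G` of it computes `RG` in degrees `≤
  -- 1`, while `H` of `J` computes `RH` in all degrees.
  have hK : IsOneAcyclic G (K.obj.X 0) := hF (R.cochainComplex.X 0)
  have := isIso_truncLE_one_map_rightDerivedFunctorPlusUnit G K hK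
  let j : (HomotopyCategory.Plus.singleFunctor C 0).obj A ⟶
      (HomotopyCategory.Plus.quotient C).obj J :=
    ObjectProperty.homMk ((HomotopyCategory.quotient _ _).map R.ι')
  have : IsIso (Plus.Qh.map j) := by
    have : IsIso (Plus.ι.map (Plus.Qh.map j)) := inferInstanceAs (IsIso (Q.map R.ι'))
    exact isIso_of_fully_faithful Plus.ι _
  let j' : (HomotopyCategory.Plus.singleFunctor D 0).obj A' ⟶
      (HomotopyCategory.Plus.quotient D).obj K :=
    (HomotopyCategory.Plus.singleFunctor D 0).map g ≫ singleMap F A ≫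
      F.mapHomotopyCategoryPlus.map j
  let c : G.mapHomotopyCategoryPlus.obj ((HomotopyCategory.Plus.quotient D).obj K) ⟶
      H.mapHomotopyCategoryPlus.obj ((HomotopyCategory.Plus.quotient C).obj J) :=
    ObjectProperty.homMk ((HomotopyCategory.quotient _ _).map (mapCompIso e J.obj).hom)
  have hc : (HomotopyCategory.Plus.singleFunctor E 0).map w ≫ singleMap H A ≫
        H.mapHomotopyCategoryPlus.map j =
      ((HomotopyCategory.Plus.singleFunctor E 0).map v ≫ singleMap G A' ≫
        G.mapHomotopyCategoryPlus.map j') ≫ c := by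
    subst hw
    ext
    exact congr((HomotopyCategory.quotient _ _).map $(single_comp_eq e g v R.ι'))
  have : IsIso (H.rightDerivedFunctorPlusUnit.app ((HomotopyCategory.Plus.quotient C).obj J)) :=
    inferInstance
  -- The zigzag is `RG(A') ⟶ RG(K) ⟵ G(K) ≅ H(J) ⟶ RH(J) ≅ RH(A)`. The backward arrow is the unit at
  -- `K`, invertible after truncation.
  refine ⟨_, liftTruncLE_comp_eq TStructure.t 1 _ _
    (Plus.ι.map (Plus.Qh.map ((HomotopyCategory.Plus.singleFunctor E 0).map v ≫ singleMap G A' ≫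
      G.mapHomotopyCategoryPlus.map j')))
    (Plus.ι.map (G.rightDerivedFunctorPlus.map (Plus.Qh.map j')))
    (Plus.ι.map (G.rightDerivedFunctorPlusUnit.app ((HomotopyCategory.Plus.quotient D).obj K)))
    (Plus.ι.map (Plus.Qh.map c ≫
      H.rightDerivedFunctorPlusUnit.app ((HomotopyCategory.Plus.quotient C).obj J) ≫
      inv (H.rightDerivedFunctorPlus.map (Plus.Qh.map j)))) ?_ ?_⟩
  · rw [← Functor.map_comp, ← Functor.map_comp, singleUnit_comp]
  · have h := singleUnit_comp H w j
    rw [hc, Functor.map_comp] at h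
    rw [← Functor.map_comp, (IsIso.eq_comp_inv _).2 h]
    simp only [Category.assoc]

end Comparison

/-! ### Čech 1-cocycles in injective presheaves -/

section Coinduced

variable {C : Type (u + 1)} [LargeCategory C] (P : Cᵒᵖ ⥤ AddCommGrpCat.{u + 1})

/-- The presheaf `T ↦ ∏_{T' ⟶ T} P(T')`. -/
def coinducedPresheaf : Cᵒᵖ ⥤ AddCommGrpCat.{u + 1} where
  obj T := AddCommGrpCat.of (∀ T' : C, (T' ⟶ T.unop) → P.obj (op T'))
  map f := AddCommGrpCat.ofHom
    { toFun := fun e T' z ↦ e T' (z ≫ f.unop)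
      map_zero' := rfl
      map_add' := fun _ _ ↦ rfl }
  map_id T := by ext e T' z; exact congrArg (e T') (Category.comp_id z)
  map_comp f g := by ext e T' z; exact congrArg (e T') (Category.assoc _ _ _).symm

/-- The embedding of `P` into the coinduced presheaf. -/
def toCoinduced : P ⟶ coinducedPresheaf P where
  app T := AddCommGrpCat.ofHom
    { toFun := fun a _ z ↦ P.map z.op a
      map_zero' := by funext; exact map_zero _
      map_add' := fun _ _ ↦ by funext; exact map_add _ _ _ }
  naturality T T' f := by
    ext a
    funext T'' z
    exact (congr($(P.map_comp f z.op) a)).symm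

/-- The coordinate at the identity recovers the section. -/
instance : Mono (toCoinduced P) := by
  have (T : Cᵒᵖ) : Mono ((toCoinduced P).app T) := by
    rw [AddCommGrpCat.mono_iff_injective]
    intro a b h
    have h' : P.map (𝟙 T) a = P.map (𝟙 T) b := congrFun (congrFun h T.unop) (𝟙 _)
    simpa using h'
  exact NatTrans.mono_of_mono_app _

/-- Čech 1-cocycles with values in an injective presheaf are coboundaries. -/
lemma exists_coboundary [Injective P] {W : C} {ι : Type*} {U : ι → C} (p : ∀ i, U i ⟶ W)
    (c : ∀ (i j : ι) (T : C) (x : T ⟶ U i) (y : T ⟶ U j), x ≫ p i = y ≫ p j → P.obj (op T))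
    (hnat : ∀ i j T x y h T' (t : T' ⟶ T), c i j T' (t ≫ x) (t ≫ y) (by simp [h]) =
      P.map t.op (c i j T x y h))
    (hc : ∀ i j k T x y z h h', c i j T x y h + c j k T y z h' = c i k T x z (h.trans h')) :
    ∃ e : ∀ i, P.obj (op (U i)), ∀ i j T x y h,
      P.map x.op (e i) - P.map y.op (e j) = c i j T x y h := by
  -- Injectivity makes `P` a retract of its coinduced presheaf, so it is enough to trivialize the
  -- cocycle there.
  let r : coinducedPresheaf P ⟶ P := Injective.factorThru (𝟙 P) (toCoinduced P)
  have hr : toCoinduced P ≫ r = 𝟙 P := Injective.comp_factorThru _ _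
  -- For each `t : T ⟶ W` that factors through the cover, a factorization is chosen depending only
  -- on `t`. No naturality in `T` is needed, because the coordinates of a section of the coinduced
  -- presheaf are unrelated.
  choose k y₀ hy using fun (T : C) (t : {t : T ⟶ W // ∃ (k : ι) (y : T ⟶ U k), y ≫ p k = t}) ↦
    t.property
  let l (i : ι) (T : C) (x : T ⟶ U i) :
      {t : T ⟶ W // ∃ (k : ι) (y : T ⟶ U k), y ≫ p k = t} := ⟨x ≫ p i, i, x, rfl⟩
  let e (i : ι) : (coinducedPresheaf P).obj (op (U i)) :=
    fun T x ↦ c i (k T (l i T x)) T x (y₀ T (l i T x)) (hy T (l i T x)).symm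
  -- The chosen factorization is the same for `z ≫ x` and `z ≫ y`, so this is the cocycle relation
  -- for the triple formed by these two and `y₀`.
  have key (i j T) (x : T ⟶ U i) (y : T ⟶ U j) (h : x ≫ p i = y ≫ p j) :
      (coinducedPresheaf P).map x.op (e i) =
        (coinducedPresheaf P).map y.op (e j) + (toCoinduced P).app (op T) (c i j T x y h) := by
    funext T' z
    have h' : l i T' (z ≫ x) = l j T' (z ≫ y) := by
      apply Subtype.ext
      simp only [l, Category.assoc, h]
    have hz : (z ≫ x) ≫ p i = (z ≫ y) ≫ p j := by simp [h]
    change c i (k T' (l i T' (z ≫ x))) T' (z ≫ x) _ _ =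
      c j (k T' (l j T' (z ≫ y))) T' (z ≫ y) _ _ + P.map z.op (c i j T x y h)
    rw [← hnat i j T x y h T' z, add_comm, hc]
    have aux (l₁ l₂) (hl : l₁ = l₂) (h₁ h₂) : c i (k T' l₁) T' (z ≫ x) (y₀ T' l₁) h₁ =
        c i (k T' l₂) T' (z ≫ x) (y₀ T' l₂) h₂ := by
      subst hl
      rfl
    exact aux _ _ h' _ _
  refine ⟨fun i ↦ r.app _ (e i), fun i j T x y h ↦ ?_⟩
  have n (i) (x : T ⟶ U i) : P.map x.op (r.app _ (e i)) =
      r.app _ ((coinducedPresheaf P).map x.op (e i)) :=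
    (congr($(r.naturality x.op) (e i))).symm
  have h₂ : r.app _ ((toCoinduced P).app (op T) (c i j T x y h)) = c i j T x y h :=
    congr($(congr_app hr (op T)) (c i j T x y h))
  rw [n, n, key i j T x y h, map_add, h₂, add_sub_cancel_left]

end Coinduced

/-! ### Fibre products, covers and sections on the smooth site -/

section SmoothSite

lemma baseChange_map_isPullback {X Y : Scheme.{u}} (f : X ⟶ Y) {U V W T : SmoothSite Y}
    {a : T ⟶ U} {b : T ⟶ V} {p : U ⟶ W} {q : V ⟶ W} (h : IsPullback a b p q) (hq : Smooth q.left) :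
    IsPullback ((baseChange f).map a) ((baseChange f).map b) ((baseChange f).map p)
      ((baseChange f).map q) := by
  let := createsPullback p q hq
  have : PreservesLimit (cospan p q)
      (baseChange f ⋙ MorphismProperty.Over.forget smoothProp ⊤ X) :=
    inferInstanceAs <| PreservesLimit (cospan p q)
      (MorphismProperty.Over.forget smoothProp ⊤ Y ⋙ Over.pullback f)
  have : PreservesLimit (cospan p q) (baseChange f) :=
    preservesLimit_of_reflects_of_preserves _ (MorphismProperty.Over.forget smoothProp ⊤ X)
  exact h.map _

lemma exists_isPullback {X : Scheme.{u}} {U V W : SmoothSite X} (p : U ⟶ W) (q : V ⟶ W)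
    (hq : Smooth q.left) : ∃ (T : SmoothSite X) (a : T ⟶ U) (b : T ⟶ V), IsPullback a b p q := by
  let := createsPullback p q hq
  have : HasPullback p q := hasLimit_of_created _ (MorphismProperty.Over.forget smoothProp ⊤ X)
  exact ⟨_, _, _, IsPullback.of_hasPullback p q⟩

/-- Smooth coverings are stable under composition and base change, so no transfinite saturation is
needed to generate the topology. -/
lemma exists_cover_of_mem {X : Scheme.{u}} {W : SmoothSite X} {S : Sieve W}
    (hS : S ∈ smoothTopology X W) : ∃ R ∈ smoothPrecoverage X W, R ≤ S := by
  have : (smoothPrecoverage X).IsStableUnderComposition :=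
    inferInstanceAs (Precoverage.IsStableUnderComposition (Precoverage.comap _ _))
  have : (smoothPrecoverage X).HasIsos :=
    inferInstanceAs (Precoverage.HasIsos (Precoverage.comap _ _))
  exact Precoverage.mem_toGrothendieck_iff_of_isStableUnderComposition.1 hS

/-- The inclusion of sheaves into presheaves is right adjoint to the exact sheafification functor,
hence preserves injectives. -/
instance {X : Scheme.{u}} (J : SmSheaf X) [Injective J] : Injective J.obj :=
  Injective.injective_of_adjoint (sheafificationAdjunction (smoothTopology X) AddCommGrpCat.{u + 1}) J

lemma exists_section_eq {X : Scheme.{u}} {A B Q : SmSheaf X} (i : A ⟶ B) (g : B ⟶ Q) (w : i ≫ g = 0)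
    (h : (ShortComplex.mk i g w).ShortExact) (V : SmoothSite X) :
    Function.Injective (i.hom.app (op V)) ∧
      ∀ b, g.hom.app (op V) b = 0 → ∃ a, i.hom.app (op V) a = b := by
  let Γ : SmSheaf X ⥤ AddCommGrpCat.{u + 1} :=
    sheafToPresheaf _ _ ⋙ (evaluation _ _).obj (op V)
  have := h.mono_f
  have hΓ := h.exact.map_of_mono_of_preservesKernel Γ this inferInstance
  refine ⟨?_, fun b hb ↦ (ShortComplex.ab_exact_iff _).1 hΓ b hb⟩
  have : Mono (Γ.map i) := inferInstance
  exact (AddCommGrpCat.mono_iff_injective _).1 this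

end SmoothSite

/-! ### Vanishing of first cohomology for direct images of injectives -/

section FirstCohomology

variable {X Y : Scheme.{u}}

/-- If `J` is injective, the first cohomology of `f_* J` vanishes: sections lift along
the cokernel of any monomorphism out of `f_* J`. -/
lemma surjective_app_of_injective (f : X ⟶ Y) (J : SmSheaf X) [Injective J] {A Q : SmSheaf Y}
    (m : (pushforward f).obj J ⟶ A) (g : A ⟶ Q) (w : m ≫ g = 0)
    (hS : (ShortComplex.mk m g w).ShortExact) (V : SmoothSite Y) :
    Function.Surjective (g.hom.app (op V)) := by
  intro b
  have := hS.epi_g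
  have : Presheaf.IsLocallySurjective (smoothTopology Y) g.hom :=
    (Sheaf.isLocallySurjective_iff_epi' _ g).2 this
  obtain ⟨R, hR, hRle⟩ := exists_cover_of_mem
    (Presheaf.imageSieve_mem (smoothTopology Y) g.hom (U := op V) b)
  obtain ⟨ι, U, p, rfl⟩ := R.exists_eq_ofArrows
  have hp (i : ι) : Smooth (p i).left := exists_smooth_of_mem hR ⟨i⟩
  choose a ha using fun i ↦ hRle _ _ (Presieve.ofArrows.mk i)
  -- the differences of the local lifts
  have hδ (i j : ι) (T : SmoothSite Y) (x : T ⟶ U i) (y : T ⟶ U j) (h : x ≫ p i = y ≫ p j) :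
      ∃ d : J.obj.obj (op ((baseChange f).obj T)),
        m.hom.app (op T) d = A.obj.map x.op (a i) - A.obj.map y.op (a j) := by
    refine (exists_section_eq m g w hS T).2 _ ?_
    have e (i) (x : T ⟶ U i) : g.hom.app (op T) (A.obj.map x.op (a i)) =
        Q.obj.map (x ≫ p i).op b := by
      rw [op_comp, Q.obj.map_comp]
      refine (congr($(g.hom.naturality x.op) (a i))).trans ?_
      exact congr(Q.obj.map x.op $(ha i))
    rw [map_sub, e, e, h, sub_self]
  choose δ hδ using hδ
  have inj (T : SmoothSite Y) := (exists_section_eq m g w hS T).1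
  have δ_nat (i j T x y h T') (t : T' ⟶ T) :
      δ i j T' (t ≫ x) (t ≫ y) (by simp [h]) =
        J.obj.map ((baseChange f).map t).op (δ i j T x y h) := by
    apply inj
    rw [hδ]
    refine Eq.trans ?_ (congr($(m.hom.naturality t.op) (δ i j T x y h))).symm
    refine Eq.trans ?_ (congr(A.obj.map t.op $(hδ i j T x y h))).symm
    rw [map_sub, op_comp, op_comp, A.obj.map_comp, A.obj.map_comp]
    rfl
  have δ_add (i j k T x y z h h') : δ i j T x y h + δ j k T y z h' = δ i k T x z (h.trans h') := by
    apply inj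
    refine (map_add _ _ _).trans ?_
    rw [hδ, hδ, hδ, sub_add_sub_cancel]
  choose P pr₁ pr₂ hP using fun i j ↦ exists_isPullback (p i) (p j) (hp j)
  have hP' (i j) := baseChange_map_isPullback f (hP i j) (hp j)
  -- The cocycle `δ` is defined on test objects of `Y_sm` only. Base change preserves the fibre
  -- products `P i j`, so pulling back the universal value of `δ` extends it to all test objects of
  -- `X_sm`.
  let c (i j) (T : SmoothSite X) (x : T ⟶ (baseChange f).obj (U i))
      (y : T ⟶ (baseChange f).obj (U j))
      (h : x ≫ (baseChange f).map (p i) = y ≫ (baseChange f).map (p j)) : J.obj.obj (op T) :=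
    J.obj.map ((hP' i j).lift x y h).op (δ i j (P i j) (pr₁ i j) (pr₂ i j) (hP i j).w)
  -- The extension may be computed through any object of `Y_sm` over which the pair of morphisms is
  -- defined.
  have c_eq (i j) (T : SmoothSite X) (T') (t : T ⟶ (baseChange f).obj T') (x : T' ⟶ U i)
      (y : T' ⟶ U j) (h : x ≫ p i = y ≫ p j) (x' y' h') (hx : x' = t ≫ (baseChange f).map x)
      (hy : y' = t ≫ (baseChange f).map y) :
      c i j T x' y' h' = J.obj.map t.op (δ i j T' x y h) := by
    subst hx hy
    have e : (hP' i j).lift _ _ h' = t ≫ (baseChange f).map ((hP i j).lift x y h) := by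
      apply (hP' i j).hom_ext
      · rw [IsPullback.lift_fst, Category.assoc, ← Functor.map_comp, IsPullback.lift_fst]
      · rw [IsPullback.lift_snd, Category.assoc, ← Functor.map_comp, IsPullback.lift_snd]
    have e' := δ_nat i j _ _ _ (hP i j).w _ ((hP i j).lift x y h)
    simp only [IsPullback.lift_fst, IsPullback.lift_snd] at e'
    rw [e']
    simp only [c]
    rw [e, op_comp, J.obj.map_comp]
    rfl
  obtain ⟨e, he⟩ := exists_coboundary J.obj (fun i ↦ (baseChange f).map (p i)) c (by
    intro i j T x y h T' t
    have : (hP' i j).lift (t ≫ x) (t ≫ y) (by simp [h]) = t ≫ (hP' i j).lift x y h := by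
      apply (hP' i j).hom_ext <;> simp
    simp only [c]
    rw [this, op_comp, J.obj.map_comp]
    rfl) (by
    intro i j k T x y z h h'
    -- `T'` is the triple fibre product over `W`. Through its base change, the cocycle relation for
    -- `c` follows from that for `δ`.
    obtain ⟨T', q₁, q₂, hT⟩ := exists_isPullback (pr₁ i j ≫ p i) (p k) (hp k)
    have hT' := baseChange_map_isPullback f hT (hp k)
    have h₁ : (q₁ ≫ pr₁ i j) ≫ p i = (q₁ ≫ pr₂ i j) ≫ p j := by
      rw [Category.assoc, Category.assoc, (hP i j).w]
    have h₂ : (q₁ ≫ pr₂ i j) ≫ p j = q₂ ≫ p k := by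
      rw [← h₁, Category.assoc, hT.w]
    let t : T ⟶ (baseChange f).obj T' := hT'.lift ((hP' i j).lift x y h) z (by
      rw [Functor.map_comp, IsPullback.lift_fst_assoc, h, h'])
    have hx : x = t ≫ (baseChange f).map (q₁ ≫ pr₁ i j) := by
      rw [Functor.map_comp, IsPullback.lift_fst_assoc, IsPullback.lift_fst]
    have hy : y = t ≫ (baseChange f).map (q₁ ≫ pr₂ i j) := by
      rw [Functor.map_comp, IsPullback.lift_fst_assoc, IsPullback.lift_snd]
    have hz : z = t ≫ (baseChange f).map q₂ := by rw [IsPullback.lift_snd]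
    rw [c_eq i j T T' t _ _ h₁ x y h hx hy, c_eq j k T T' t _ _ h₂ y z h' hy hz,
      c_eq i k T T' t _ _ (h₁.trans h₂) x z _ hx hz, ← map_add, δ_add])
  have hsheaf (F : SmSheaf Y) :
      Presieve.IsSheafFor (F.obj ⋙ forget AddCommGrpCat.{u + 1}) (Presieve.ofArrows U p) := by
    have h₁ : Presheaf.IsSheaf (smoothTopology Y) (F.obj ⋙ forget AddCommGrpCat.{u + 1}) :=
      (Presheaf.isSheaf_iff_isSheaf_forget _ _ _).1 F.property
    exact (Presieve.isSheafFor_iff_generate _).2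
      ((isSheaf_iff_isSheaf_of_type _ _).1 h₁ _ (Precoverage.generate_mem_toGrothendieck hR))
  have m_nat (T T' : SmoothSite Y) (t : T' ⟶ T) (d : J.obj.obj (op ((baseChange f).obj T))) :
      A.obj.map t.op (m.hom.app (op T) d) =
        m.hom.app (op T') (J.obj.map ((baseChange f).map t).op d) :=
    (congr($(m.hom.naturality t.op) d)).symm
  -- Subtracting the cochain `e` makes the local lifts agree on overlaps. Their images in `Q` do not
  -- change, since `m ≫ g = 0`.
  obtain ⟨s, hs, -⟩ := (Presieve.isSheafFor_arrows_iff _ _).1 (hsheaf A)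
    (fun i ↦ a i - m.hom.app (op (U i)) (e i)) (by
      intro i j T x y h
      change A.obj.map x.op (a i - m.hom.app (op (U i)) (e i)) =
        A.obj.map y.op (a j - m.hom.app (op (U j)) (e j))
      have h₁ := he i j ((baseChange f).obj T) ((baseChange f).map x) ((baseChange f).map y)
        (by rw [← Functor.map_comp, h, Functor.map_comp])
      rw [c_eq i j _ T (𝟙 _) x y h _ _ _ (Category.id_comp _).symm (Category.id_comp _).symm] at h₁
      have h₂ := hδ i j T x y h
      rw [map_sub, map_sub, m_nat, m_nat, sub_eq_sub_iff_sub_eq_sub, ← h₂]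
      refine Eq.trans ?_ (map_sub (m.hom.app (op T)).hom _ _)
      refine congrArg (m.hom.app (op T)) (Eq.trans ?_ h₁.symm)
      rw [op_id, J.obj.map_id]
      rfl)
  refine ⟨s, ((hsheaf Q).isSeparatedFor).ext ?_⟩
  rintro _ _ ⟨i⟩
  have h₁ : A.obj.map (p i).op s = a i - m.hom.app (op (U i)) (e i) := hs i
  have h₂ : g.hom.app (op (U i)) (m.hom.app (op (U i)) (e i)) = 0 :=
    congr($(congr_app (congrArg (fun k ↦ k.hom) w) (op (U i))) (e i))
  refine (congr($(g.hom.naturality (p i).op) s)).symm.trans ?_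
  refine (congrArg (g.hom.app (op (U i))) h₁).trans ?_
  rw [map_sub, h₂, sub_zero]
  exact ha i

/-- The direct image of an injective sheaf has no first higher direct images. -/
lemma isOneAcyclic_pushforward {Z : Scheme.{u}} (f : X ⟶ Y) (g : Y ⟶ Z) (J : SmSheaf X)
    [Injective J] : IsOneAcyclic (pushforward g) ((pushforward f).obj J) := by
  intro A Q m q w hS
  rw [← Sheaf.isLocallySurjective_iff_epi']
  exact Presheaf.isLocallySurjective_of_surjective _ _
    fun V ↦ surjective_app_of_injective f J m q w hS _

end FirstCohomology

/-! ### Functoriality of the truncated complexes and of the degree -/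

section Functoriality

variable {X Y Z : Scheme.{u}}

/-- Direct images are compatible with composition. -/
noncomputable def pushforwardComp (f : X ⟶ Y) (g : Y ⟶ Z) :
    pushforward f ⋙ pushforward g ≅ pushforward (f ≫ g) :=
  NatIso.ofComponents
    (fun F ↦ ObjectProperty.isoMk _ (Functor.isoWhiskerRight
      (NatIso.op (MorphismProperty.Over.pullbackComp (P := smoothProp) (Q := ⊤) f g)) F.obj))
    (fun α ↦ by
      ext V x
      exact congr($((α.hom.naturality ((MorphismProperty.Over.pullbackComp (P := smoothProp)
        (Q := ⊤) f g (f ≫ g)).hom.app V.unop).op).symm) x))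

lemma unitsPresheaf_map_eq {S₀ S₁ S₂ S₃ : Scheme.{u}} {a : S₀ ⟶ S₁} {b : S₁ ⟶ S₂} {c : S₂ ⟶ S₃}
    {d : S₀ ⟶ S₃} (h : a ≫ b ≫ c = d) :
    unitsPresheaf.map d.op =
      unitsPresheaf.map c.op ≫ unitsPresheaf.map b.op ≫ unitsPresheaf.map a.op := by
  rw [← h, op_comp, op_comp, Functor.map_comp, Functor.map_comp, Category.assoc]

/-- Over `V`, both sides pull units back along the projection to `V`, once directly and once through
the iterated fibre product. -/
lemma unitsPullback_comp (f : X ⟶ Y) (g : Y ⟶ Z) :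
    unitsPullback (f ≫ g) =
      unitsPullback g ≫ (pushforward g).map (unitsPullback f) ≫
        (pushforwardComp f g).hom.app (Gm X) := by
  ext V x
  have h := MorphismProperty.Over.pullbackComp_left_fst_fst (P := smoothProp) (Q := ⊤) f g
    V.unop
  exact congr($(unitsPresheaf_map_eq h) x)

/-- A morphism `f : X ⟶ Y` of `Z`-schemes induces a morphism `τ_{≤ 1} Rg_* 𝔾_{m,Y} ⟶
τ_{≤ 1} R(f ≫ g)_* 𝔾_{m,X}` which is compatible with the natural morphisms from `𝔾_{m,Z}`. -/
lemma exists_truncRpushGm_map (f : X ⟶ Y) (g : Y ⟶ Z) :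
    ∃ t : truncRpushGm g ⟶ truncRpushGm (f ≫ g), naturalMap g ≫ t = naturalMap (f ≫ g) := by
  have : DerivedCategory.TStructure.t.IsLE (DerivedCategory.Plus.ι.obj (DerivedCategory.Plus.Qh.obj
      ((HomotopyCategory.Plus.singleFunctor (SmSheaf Z) 0).obj (Gm Z)))) 1 :=
    inferInstanceAs (DerivedCategory.TStructure.t.IsLE (GmD Z) 1)
  exact exists_truncLE_map (pushforwardComp f g) (fun J _ ↦ isOneAcyclic_pushforward f g J)
    (unitsPullback f) (unitsPullback g) (unitsPullback (f ≫ g)) (unitsPullback_comp f g)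

/-- A class `h` for `X` is pushed forward to the class `t ≫ h` for `Y`, which has the same degree
because `t` respects the natural maps. -/
lemma range_deg_comp_le {k : Type u} [Field k] (f : X ⟶ Y) (ψ : Y ⟶ Spec (.of k)) :
    (deg (f ≫ ψ)).range ≤ (deg ψ).range := by
  rintro _ ⟨h, rfl⟩
  obtain ⟨t, ht⟩ := exists_truncRpushGm_map f ψ
  refine ⟨t ≫ h, ?_⟩
  change (intEquivEndGm k).symm (naturalMap ψ ≫ t ≫ h) =
    (intEquivEndGm k).symm (naturalMap (f ≫ ψ) ≫ h)
  rw [← ht, Category.assoc]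

end Functoriality

end TruncatedHomology

theorem mainTheorem7 {k : Type u} [Field k] [CharZero k] {X Y : Scheme.{u}}
    (φ : X ⟶ Spec (.of k)) (ψ : Y ⟶ Spec (.of k)) [IsProper φ] [IsProper ψ]
    [GeometricallyIntegral φ] [GeometricallyIntegral ψ] (f : X ⟶ Y) (hf : f ≫ ψ = φ) :
    TruncatedHomology.pseudoIndex ψ ∣ TruncatedHomology.pseudoIndex φ := by
  subst hf
  -- The pseudo-index is by definition the index of the image of the degree map, and the index of a
  -- subgroup divides that of any smaller one, also with the convention that an infinite index is
  -- `0`.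
  exact AddSubgroup.index_dvd_of_le (TruncatedHomology.range_deg_comp_le f ψ)
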